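/- Let $m,n\ge 1$ be integers and let $A\in\mathbb{Z}^{m\times n}$ have full row rank. Let $W$ be a submatrix of $A$ formed by a subset of its columns such that $\operatorname{cone}(A)=\operatorname{cone}(W)$, where $\operatorname{cone}(\cdot)$ denotes the set of all nonnegative real linear combinations of the columns. For $b\in\mathbb{Z}^m$ put $P(A,b):=\{x\in\mathbb{Z}^n_{\ge 0}: Ax=b\}$, and let $\sigma(A,b)$ be the minimum number of nonzero entries of a point of $P(A,b)$, with $\sigma(A,b):=\infty$ if $P(A,b)=\emptyset$. Define $$\sigma^{\mathrm{asy}}(A):=\min\left\{k\in\mathbb{Z}:\ \lim_{t\to\infty}\frac{|\{b\in\{-t,\dots,t\}^m:\ \sigma(A,b)\le k\}|}{|\{b\in\{-t,\dots,t\}^m:\ P(A,b)\ne\emptyset\}|}=1\right\}.$$ Let $\delta^{\max}(W)$ and $\delta^{\min}(W)$ be the maximum and the minimum of $|\det(W')|$, and let $\phi^{\max}(W)$ and $\phi^{\min}(W)$ be the maximum and the minimum of the number of prime factors of $|\det(W')|$, counted with multiplicity (so that $|\det(W')|=1$ gives $0$), where in each case $W'$ ranges over the invertible $m\times m$ submatrices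 of $W$. Then all these minima and maxima exist, and 1. $\sigma^{\mathrm{asy}}(A)\le m+\phi^{\max}(W)\le m+\log_2\left(\delta^{\max}(W)\right)$; 2. $\sigma^{\mathrm{asy}}(A)\le 2m+\phi^{\min}(W)\le 2m+\log_2\left(\delta^{\min}(W)\right)$. -/

import Mathlib

open Filter Topology Matrix

namespace SparseIP

/-- The feasible set `P(A, b)` of nonnegative integer solutions of `A x = b`. -/
def feasible {m n : ℕ} (A : Matrix (Fin m) (Fin n) ℤ) (b : Fin m → ℤ) : Set (Fin n → ℤ) :=
  {x | (∀ j, 0 ≤ x j) ∧ A *ᵥ x = b}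

/-- The number of nonzero entries of `x`. -/
def suppCard {n : ℕ} (x : Fin n → ℤ) : ℕ :=
  (Finset.univ.filter fun j => x j ≠ 0).card

/-- The support function `σ(A, b)`: the least support size of a point of `P(A, b)`, and `∞` when
`P(A, b)` is empty. -/
noncomputable def sigma {m n : ℕ} (A : Matrix (Fin m) (Fin n) ℤ) (b : Fin m → ℤ) : ℕ∞ :=
  ⨅ z ∈ feasible A b, (suppCard z : ℕ∞)

/-- The discrete box `{-t, …, t}^m`. -/
def box (m t : ℕ) : Set (Fin m → ℤ) :=
  {b | ∀ i, -(t : ℤ) ≤ b i ∧ b i ≤ (t : ℤ)}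

/-- The fraction, among the feasible right-hand sides `b` in `{-t, …, t}^m`, of those with
`σ(A, b) ≤ k`. -/
noncomputable def ratio {m n : ℕ} (A : Matrix (Fin m) (Fin n) ℤ) (k : ℤ) (t : ℕ) : ℝ :=
  ({b | b ∈ box m t ∧ ∃ s : ℕ, sigma A b = (s : ℕ∞) ∧ (s : ℤ) ≤ k}.ncard : ℝ) /
    ({b | b ∈ box m t ∧ (feasible A b).Nonempty}.ncard : ℝ)

/-- The integers `k` such that almost all feasible right-hand sides have `σ(A, b) ≤ k`. -/
def asySet {m n : ℕ} (A : Matrix (Fin m) (Fin n) ℤ) : Set ℤ :=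
  {k | Tendsto (ratio A k) atTop (𝓝 1)}

/-- The asymptotic support function `σ^asy(A)`. -/
noncomputable def sigmaAsy {m n : ℕ} (A : Matrix (Fin m) (Fin n) ℤ) : ℤ :=
  sInf (asySet A)

/-- The convex cone in `ℝ^m` generated by the columns of an integer matrix. -/
noncomputable def cone {m : ℕ} {ι : Type*} (A : Matrix (Fin m) ι ℤ) :
    PointedCone ℝ (Fin m → ℝ) :=
  PointedCone.hull ℝ (Set.range fun j : ι => fun i : Fin m => (A i j : ℝ))

/-- The submatrix of `A` consisting of the columns indexed by `S`. -/
def cols {m n : ℕ} (A : Matrix (Fin m) (Fin n) ℤ) (S : Finset (Fin n)) : Matrix (Fin m) S ℤ :=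
  A.submatrix id (fun j : S => (j : Fin n))

/-- The set `Δ(W)` of absolute values of the nonzero `m × m` minors of `W`. -/
def Delta {m : ℕ} {ι : Type*} (W : Matrix (Fin m) ι ℤ) : Set ℕ :=
  {d | ∃ f : Fin m ↪ ι, (W.submatrix id f).det ≠ 0 ∧ (W.submatrix id f).det.natAbs = d}

/-- The set `Φ(W)` of the numbers of prime factors, counted with multiplicity, of the nonzero
`m × m` minors of `W`. A minor `±1` is the empty product and contributes `0`. -/
def Phi {m : ℕ} {ι : Type*} (W : Matrix (Fin m) ι ℤ) : Set ℕ :=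
  {t | ∃ f : Fin m ↪ ι, (W.submatrix id f).det ≠ 0 ∧
    ∃ α : Fin t → ℕ, (∀ i, (α i).Prime) ∧ (W.submatrix id f).det.natAbs = ∏ i, α i}

noncomputable def deltaMax {m : ℕ} {ι : Type*} (W : Matrix (Fin m) ι ℤ) : ℕ := sSup (Delta W)

noncomputable def deltaMin {m : ℕ} {ι : Type*} (W : Matrix (Fin m) ι ℤ) : ℕ := sInf (Delta W)

noncomputable def phiMax {m : ℕ} {ι : Type*} (W : Matrix (Fin m) ι ℤ) : ℕ := sSup (Phi W)

noncomputable def phiMin {m : ℕ} {ι : Type*} (W : Matrix (Fin m) ι ℤ) : ℕ := sInf (Phi W)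

end SparseIP

/-!
Fix a basis `f` of the space among the columns of `W`, with matrix `B`. The quotient of `ℤ^m` by the
lattice `Bℤ^m` is a finite group of order `|det B|`, and in a finite abelian group each subgroup
generated by some elements is already generated by at most `Ω(|G|)` of them, because every element
that is really needed enlarges the subgroup and so adds a prime factor to its order
(`exists_card_le_cardFactors_det`). So there is a set `T` of at most `Ω(|det B|)` columns that
generates, together with `B`, the lattice of all columns of `A`.

Whenever `B` and a set `T` of columns generate this lattice, every feasible `b` that lies deep inside
the simplicial cone of `B` has a solution supported on `f` and `T`: the coefficients of the columns
in `T` can be reduced modulo `|det B|`, after which they are nonnegative and bounded, and the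
coefficients on `B` are nonnegative because `b` is deep (`exists_sigma_le_of_deep`).

By Carathéodory's theorem for cones, every feasible `b` lies in the simplicial cone of some basis
among the columns of `W` (`exists_basis_of_mem_cone`). If it is not deep there, it lies within a
bounded distance of one of finitely many hyperplanes, and such `b` are `O(t^(m-1))` in number
(`negligible_slab`), whereas the feasible `b` in the box are at least a constant times `t^m`
(`exists_le_ncard_feasible`). Hence `m + k` bounds the support for almost all `b` if each basis
admits a `T` with at most `k` members (`add_mem_asySet`).

For the first bound, `T` is chosen for each basis separately, with `k = φ^max(W)`. For the second
one, let `g` be a basis whose minor has `φ^min(W)` prime factors: its `m` columns and `φ^min(W)`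
further ones generate the whole lattice, and this set of `m + φ^min(W)` columns serves as `T` for
every basis. The logarithmic bounds are `2 ^ Ω(d) ≤ d`.
-/

namespace SparseIP

/-! ### Generating sets in finite abelian groups -/

/-- A proper inclusion of finite groups raises the number of prime factors of the order. -/
theorem cardFactors_card_lt {G : Type*} [AddCommGroup G] [Finite G] {N N' : Submodule ℤ G}
    (h : N < N') :
    ArithmeticFunction.cardFactors (Nat.card N) < ArithmeticFunction.cardFactors (Nat.card N') := by
  have hdvd : Nat.card N ∣ Nat.card N' :=
    AddSubgroup.card_dvd_of_le (H := N.toAddSubgroup) (K := N'.toAddSubgroup) h.le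
  have hlt : Nat.card N < Nat.card N' :=
    Set.ncard_lt_ncard (s := (N : Set G)) (t := (N' : Set G)) h (Set.toFinite _)
  have hN : Nat.card N ≠ 0 := Nat.card_pos.ne'
  have hN' : Nat.card N' ≠ 0 := Nat.card_pos.ne'
  obtain ⟨q, hq⟩ := hdvd
  have hq0 : q ≠ 0 := by rintro rfl; simp_all
  have hq1 : 1 < q := by
    by_contra hcon
    have : q = 1 := by omega
    simp_all
  rw [hq, ArithmeticFunction.cardFactors_mul hN hq0]
  have := ArithmeticFunction.cardFactors_pos_iff_one_lt.2 hq1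
  omega

/-- Every finite generating family of a finite abelian group contains a generating subfamily with
at most `Ω` of the group order many members. -/
theorem exists_subset_span_eq {G ι : Type*} [AddCommGroup G] [Finite G] (g : ι → G)
    (X : Finset ι) :
    ∃ Y ⊆ X, Submodule.span ℤ (g '' Y) = Submodule.span ℤ (g '' X) ∧
      Y.card ≤ ArithmeticFunction.cardFactors (Nat.card (Submodule.span ℤ (g '' X))) := by
  classical
  induction X using Finset.induction_on with
  | empty => exact ⟨∅, by simp⟩
  | insert x X hx ih =>
    obtain ⟨Y, hYX, hspan, hcard⟩ := ih
    by_cases hmem : g x ∈ Submodule.span ℤ (g '' X)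
    · have : Submodule.span ℤ (g '' (insert x X : Finset ι)) = Submodule.span ℤ (g '' X) := by
        rw [Finset.coe_insert, Set.image_insert_eq, Submodule.span_insert_eq_span hmem]
      exact ⟨Y, hYX.trans (Finset.subset_insert _ _), by rw [this, hspan], by rwa [this]⟩
    · refine ⟨insert x Y, Finset.insert_subset_insert _ hYX, ?_, ?_⟩
      · simp only [Finset.coe_insert, Set.image_insert_eq, Submodule.span_insert, hspan]
      · have hlt : Submodule.span ℤ (g '' X) <
            Submodule.span ℤ (g '' (insert x X : Finset ι)) := by
          refine lt_of_le_of_ne (Submodule.span_mono (Set.image_mono (by simp))) fun h => hmem ?_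
          rw [h]
          exact Submodule.subset_span ⟨x, by simp, rfl⟩
        exact (Finset.card_insert_le _ _).trans
          (Nat.succ_le_of_lt (hcard.trans_lt (cardFactors_card_lt hlt)))

/-! ### The lattice spanned by a square integer matrix -/

theorem mulVec_injective_of_det_ne_zero {m : ℕ} {B : Matrix (Fin m) (Fin m) ℤ}
    (hB : B.det ≠ 0) : Function.Injective (B *ᵥ ·) := by
  intro x y hxy
  have h : B *ᵥ (x - y) = 0 := by
    rw [Matrix.mulVec_sub]; exact sub_eq_zero.2 hxy
  exact sub_eq_zero.1 (Matrix.eq_zero_of_mulVec_eq_zero hB h)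

theorem card_quotient_range_mulVecLin {m : ℕ} {B : Matrix (Fin m) (Fin m) ℤ}
    (hB : B.det ≠ 0) :
    Nat.card ((Fin m → ℤ) ⧸ LinearMap.range B.mulVecLin) = B.det.natAbs := by
  have hinj : Function.Injective B.mulVecLin := mulVec_injective_of_det_ne_zero hB
  have h := Submodule.natAbs_det_equiv (LinearMap.range B.mulVecLin)
    (LinearEquiv.ofInjective B.mulVecLin hinj)
  rw [← h, ← LinearMap.det_toLin' B]
  rfl

/-- Finitely many vectors of `ℤ^m` can be thinned out to at most `Ω(|det B|)` vectors without
changing the lattice that they span together with the columns of `B`. -/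
theorem exists_card_le_cardFactors_det {m : ℕ} {ι : Type*} [Fintype ι]
    {B : Matrix (Fin m) (Fin m) ℤ} (hB : B.det ≠ 0) (a : ι → Fin m → ℤ) :
    ∃ Y : Finset ι, Y.card ≤ ArithmeticFunction.cardFactors B.det.natAbs ∧
      ∀ j, a j ∈ LinearMap.range B.mulVecLin ⊔ Submodule.span ℤ (a '' Y) := by
  set N := LinearMap.range B.mulVecLin with hN
  have hcard := card_quotient_range_mulVecLin hB
  have hpos : 0 < B.det.natAbs := Int.natAbs_pos.2 hB
  have : Finite ((Fin m → ℤ) ⧸ N) := Nat.finite_of_card_ne_zero (hcard ▸ hpos.ne')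
  obtain ⟨Y, -, hspan, hY⟩ := exists_subset_span_eq (fun j => N.mkQ (a j)) Finset.univ
  refine ⟨Y, hY.trans ?_, fun j => ?_⟩
  · rw [← hcard]
    by_cases h : Submodule.span ℤ ((fun j => N.mkQ (a j)) '' (Finset.univ : Finset ι)) = ⊤
    · rw [h]; exact (congrArg _ (Nat.card_congr Submodule.topEquiv.toEquiv)).le
    · refine (cardFactors_card_lt (lt_top_iff_ne_top.2 h)).le.trans ?_
      exact (congrArg _ (Nat.card_congr Submodule.topEquiv.toEquiv)).le
  · have hj : N.mkQ (a j) ∈ Submodule.span ℤ ((fun j => N.mkQ (a j)) '' Y) := by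
      rw [hspan]; exact Submodule.subset_span ⟨j, by simp, rfl⟩
    rw [← Submodule.comap_map_mkQ, Submodule.mem_comap, Submodule.map_span, Set.image_image]
    exact hj

/-! ### Sparse solutions deep inside a simplicial cone -/

theorem det_natAbs_smul {m : ℕ} (B : Matrix (Fin m) (Fin m) ℤ) (x : Fin m → ℤ) :
    (B.det.natAbs : ℤ) • x = B *ᵥ (B.det.sign • (B.adjugate *ᵥ x)) := by
  rw [Matrix.mulVec_smul, Matrix.mulVec_mulVec, Matrix.mul_adjugate, Matrix.smul_mulVec,
    Matrix.one_mulVec, smul_smul, Int.sign_mul_self_eq_natAbs]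

/-- Suppose that the columns of `A` indexed by `T` generate, together with the basis `f`, the
lattice of all columns. If `b` is feasible and its coordinates with respect to the basis `f`,
scaled by `|det|`, are large, then `b` has a solution supported on `f` and `T`: reduce the
coefficients of the columns in `T` modulo `|det|`; they become nonnegative and bounded, so that the
coefficients on the basis stay nonnegative. -/
theorem exists_sigma_le_of_deep {m n : ℕ} (A : Matrix (Fin m) (Fin n) ℤ) (f : Fin m → Fin n)
    (hdet : (A.submatrix id f).det ≠ 0) (T : Finset (Fin n))
    (hT : ∀ j, A.col j ∈ LinearMap.range (A.submatrix id f).mulVecLin ⊔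
      Submodule.span ℤ (A.col '' T)) :
    ∃ C : ℤ, ∀ b, (feasible A b).Nonempty →
      (∀ i, C ≤ (A.submatrix id f).det.sign * ((A.submatrix id f).adjugate *ᵥ b) i) →
      sigma A b ≤ ((m + T.card : ℕ) : ℕ∞) := by
  classical
  set B := A.submatrix id f with hB
  set D : ℤ := (B.det.natAbs : ℤ) with hD
  have hDpos : 0 < D := by simpa [hD] using hdet
  -- `w j` is `|det B| • B⁻¹ (A.col j)`
  set w : Fin n → Fin m → ℤ := fun j => B.det.sign • (B.adjugate *ᵥ A.col j) with hw
  have hBw (j : Fin n) : B *ᵥ w j = D • A.col j := (det_natAbs_smul B _).symm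
  have hwB (z : Fin m → ℤ) : B.det.sign • (B.adjugate *ᵥ (B *ᵥ z)) = D • z := by
    rw [Matrix.mulVec_mulVec, Matrix.adjugate_mul, Matrix.smul_mulVec, Matrix.one_mulVec,
      smul_smul, Int.sign_mul_self_eq_natAbs]
  refine ⟨∑ i, ∑ j ∈ T, D * |w j i|, fun b hb hdeep => ?_⟩
  have hbmem : b ∈ LinearMap.range B.mulVecLin ⊔ Submodule.span ℤ (A.col '' T) := by
    obtain ⟨x, -, rfl⟩ := hb
    have : A *ᵥ x = ∑ j, x j • A.col j := by
      ext i; simp [Matrix.mulVec, dotProduct, mul_comm]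
    rw [this]
    exact Submodule.sum_mem _ fun j _ => Submodule.smul_mem _ _ (hT j)
  obtain ⟨_, ⟨z, rfl⟩, y, hy, hzy⟩ := Submodule.mem_sup.1 hbmem
  obtain ⟨u, rfl⟩ := (Submodule.mem_span_image_finset_iff_exists_fun' ℤ).1 hy
  rw [Matrix.mulVecLin_apply] at hzy
  set z' : Fin m → ℤ := z + ∑ j ∈ T, (u j / D) • w j with hz'
  have hb' : b = B *ᵥ z' + ∑ j ∈ T, (u j % D) • A.col j := by
    rw [← hzy, hz', Matrix.mulVec_add, add_assoc, Matrix.mulVec_sum, ← Finset.sum_add_distrib]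
    congr 1
    refine Finset.sum_congr rfl fun j _ => ?_
    rw [Matrix.mulVec_smul, hBw, smul_smul, ← add_smul, mul_comm, Int.mul_ediv_add_emod]
  have hz'_nonneg (i : Fin m) : 0 ≤ z' i := by
    have h1 : B.det.sign * (B.adjugate *ᵥ b) i = D * z' i + ∑ j ∈ T, (u j % D) * w j i := by
      have h2 : B.det.sign • (B.adjugate *ᵥ b) = D • z' + ∑ j ∈ T, (u j % D) • w j := by
        rw [hb', Matrix.mulVec_add, smul_add, hwB, Matrix.mulVec_sum, Finset.smul_sum]
        congr 1
        refine Finset.sum_congr rfl fun j _ => ?_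
        rw [Matrix.mulVec_smul, smul_comm]
      simpa using congrFun h2 i
    have h3 : ∑ j ∈ T, (u j % D) * w j i ≤ ∑ j ∈ T, D * |w j i| := by
      refine Finset.sum_le_sum fun j _ => ?_
      have h0 := Int.emod_nonneg (u j) hDpos.ne'
      have h1 := (Int.emod_lt_of_pos (u j) hDpos).le
      exact (mul_le_mul_of_nonneg_left (le_abs_self _) h0).trans
        (mul_le_mul_of_nonneg_right h1 (abs_nonneg _))
    have h4 : ∑ j ∈ T, D * |w j i| ≤ ∑ i, ∑ j ∈ T, D * |w j i| :=
      Finset.single_le_sum (f := fun i => ∑ j ∈ T, D * |w j i|)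
        (fun i _ => Finset.sum_nonneg fun j _ => by positivity) (Finset.mem_univ i)
    have h5 := hdeep i
    rw [h1] at h5
    exact nonneg_of_mul_nonneg_right (by linarith : 0 ≤ D * z' i) hDpos
  set x : Fin n → ℤ := ∑ i, Pi.single (f i) (z' i) + ∑ j ∈ T, Pi.single j (u j % D) with hx
  have hxfeas : x ∈ feasible A b := by
    constructor
    · intro k
      have h1 : 0 ≤ ∑ i, (Pi.single (f i) (z' i) : Fin n → ℤ) :=
        Finset.sum_nonneg fun i _ => Pi.single_nonneg.2 (hz'_nonneg i)
      have h2 : 0 ≤ ∑ j ∈ T, (Pi.single j (u j % D) : Fin n → ℤ) :=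
        Finset.sum_nonneg fun j _ => Pi.single_nonneg.2 (Int.emod_nonneg _ hDpos.ne')
      exact (add_nonneg h1 h2) k
    · rw [hb', hx, Matrix.mulVec_add, Matrix.mulVec_sum, Matrix.mulVec_sum]
      congr 1
      · ext i
        simp [Matrix.mulVec, dotProduct, hB, mul_comm]
      · refine Finset.sum_congr rfl fun j _ => ?_
        ext i; simp [mul_comm]
  have hsupp : suppCard x ≤ m + T.card := by
    have hsub : (Finset.univ.filter fun j => x j ≠ 0) ⊆ Finset.univ.image f ∪ T := by
      intro k hk
      by_contra hcon
      simp only [Finset.mem_union, Finset.mem_image, Finset.mem_univ, true_and, not_or,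
        not_exists] at hcon
      refine (Finset.mem_filter.1 hk).2 ?_
      simp only [hx, Pi.add_apply, Finset.sum_apply]
      rw [Finset.sum_eq_zero, Finset.sum_eq_zero, add_zero]
      · intro j hj
        exact Pi.single_eq_of_ne (by rintro rfl; exact hcon.2 hj) _
      · intro i _
        exact Pi.single_eq_of_ne (fun h => hcon.1 i h.symm) _
    refine (Finset.card_le_card hsub).trans ((Finset.card_union_le _ _).trans ?_)
    have := Finset.card_image_le (s := Finset.univ) (f := f)
    rw [Finset.card_univ, Fintype.card_fin] at this
    omega
  exact (iInf₂_le x hxfeas).trans (by exact_mod_cast hsupp)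

/-! ### Counting lattice points in boxes -/

theorem box_eq_Icc (m t : ℕ) :
    box m t = (Finset.Icc (fun _ => -(t : ℤ)) (fun _ => (t : ℤ)) : Finset (Fin m → ℤ)) := by
  ext b
  simp [box, Pi.le_def, forall_and]

theorem finite_box (m t : ℕ) : (box m t).Finite := by
  rw [box_eq_Icc]; exact Finset.finite_toSet _

theorem ncard_box (m t : ℕ) : (box m t).ncard = (2 * t + 1) ^ m := by
  rw [box_eq_Icc, Set.ncard_coe_finset, Pi.card_Icc]
  simp only [Int.card_Icc, Finset.prod_const, Finset.card_univ, Fintype.card_fin]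
  congr 1
  omega

/-- A set of integer vectors is negligible if it has `O(t^(m-1))` members in the box
`{-t, …, t}^m`. The factor `2t + 1` stands on the left so that `m - 1` does not occur. -/
def Negligible {m : ℕ} (X : Set (Fin m → ℤ)) : Prop :=
  ∃ K : ℕ, ∀ t : ℕ, (X ∩ box m t).ncard * (2 * t + 1) ≤ K * (2 * t + 1) ^ m

theorem Negligible.mono {m : ℕ} {X Y : Set (Fin m → ℤ)} (hY : Negligible Y) (h : X ⊆ Y) :
    Negligible X := by
  obtain ⟨K, hK⟩ := hY
  refine ⟨K, fun t => le_trans (Nat.mul_le_mul_right _ ?_) (hK t)⟩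
  exact Set.ncard_le_ncard (Set.inter_subset_inter_left _ h)
    ((finite_box m t).subset Set.inter_subset_right)

theorem Negligible.iUnion {m : ℕ} {ι : Type*} [Finite ι] {X : ι → Set (Fin m → ℤ)}
    (hX : ∀ i, Negligible (X i)) : Negligible (⋃ i, X i) := by
  have := Fintype.ofFinite ι
  choose K hK using hX
  refine ⟨∑ i, K i, fun t => ?_⟩
  rw [Set.iUnion_inter, Finset.sum_mul]
  refine (Nat.mul_le_mul_right _ (Set.ncard_iUnion_le_of_fintype _)).trans ?_
  rw [Finset.sum_mul]
  exact Finset.sum_le_sum fun i _ => hK i t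

/-- The integer points near a hyperplane are negligible. -/
theorem negligible_slab {m : ℕ} {a : Fin m → ℤ} (ha : a ≠ 0) (C : ℤ) :
    Negligible {b : Fin m → ℤ | |a ⬝ᵥ b| ≤ C} := by
  obtain ⟨j, hj⟩ := Function.ne_iff.1 ha
  refine ⟨(Finset.Icc (-C) C).card, fun t => ?_⟩
  have hI : ((Finset.Icc (-(t : ℤ)) t : Finset ℤ) : Set ℤ).ncard = 2 * t + 1 := by
    rw [Set.ncard_coe_finset, Int.card_Icc]; omega
  rw [← ncard_box, ← hI, ← Set.ncard_coe_finset, ← Set.ncard_prod, ← Set.ncard_prod]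
  -- `b` is determined by its coordinates other than `j` together with `a ⬝ᵥ b`, so that its
  -- coordinate `j` can be overwritten by an arbitrary one without losing information
  refine Set.ncard_le_ncard_of_injOn
    (fun p : (Fin m → ℤ) × ℤ => (a ⬝ᵥ p.1, Function.update p.1 j p.2)) ?_ ?_
    ((Finset.finite_toSet _).prod (finite_box m t))
  · rintro ⟨b, u⟩ ⟨⟨hb, hbt⟩, hu⟩
    refine ⟨by simpa [abs_le] using hb, fun i => ?_⟩
    by_cases hij : i = j
    · subst hij; simpa using hu
    · simpa [hij] using hbt i
  · rintro ⟨b, u⟩ - ⟨b', u'⟩ - h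
    simp only [Prod.mk.injEq] at h ⊢
    obtain ⟨h1, h2⟩ := h
    have hu : u = u' := by simpa using congrFun h2 j
    have hne : ∀ i, i ≠ j → b i = b' i := fun i hi => by simpa [hi] using congrFun h2 i
    refine ⟨?_, hu⟩
    have h3 : a ⬝ᵥ (b - b') = a j * (b j - b' j) := by
      rw [dotProduct, Finset.sum_eq_single j]
      · rfl
      · intro i _ hi; simp [hne i hi]
      · simp
    rw [dotProduct_sub, h1, sub_self] at h3
    funext i
    by_cases hij : i = j
    · subst hij
      exact sub_eq_zero.1 ((mul_eq_zero.1 h3.symm).resolve_left hj)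
    · exact hne i hij

/-- The feasible right-hand sides have positive density: they include the nonnegative integer
combinations of a basis. -/
theorem exists_le_ncard_feasible {m n : ℕ} (A : Matrix (Fin m) (Fin n) ℤ) (f : Fin m → Fin n)
    (hdet : (A.submatrix id f).det ≠ 0) :
    ∃ K : ℕ, ∀ t : ℕ,
      (2 * t + 1) ^ m ≤ K * {b | b ∈ box m t ∧ (feasible A b).Nonempty}.ncard := by
  classical
  set B := A.submatrix id f with hB
  set M : ℕ := 1 + ∑ i, ∑ j, (B i j).natAbs with hM
  refine ⟨(2 * M) ^ m, fun t => ?_⟩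
  set s := t / M with hs
  set φ : (Fin m → Fin (s + 1)) → (Fin m → ℤ) := fun y => B *ᵥ fun j => ((y j : ℕ) : ℤ) with hφ
  have hφ_inj : Function.Injective φ := by
    intro y y' h
    have := mulVec_injective_of_det_ne_zero hdet h
    funext j
    exact Fin.ext (by exact_mod_cast congrFun this j)
  have hsub : Set.range φ ⊆ {b | b ∈ box m t ∧ (feasible A b).Nonempty} := by
    rintro _ ⟨y, rfl⟩
    refine ⟨fun i => abs_le.1 ?_, ∑ i, Pi.single (f i) ((y i : ℕ) : ℤ), ?_, ?_⟩
    · have h1 : |φ y i| ≤ ∑ j, |B i j| * s := by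
        refine (Finset.abs_sum_le_sum_abs (fun j => B i j * ((y j : ℕ) : ℤ)) _).trans
          (Finset.sum_le_sum fun j _ => ?_)
        rw [abs_mul]
        refine mul_le_mul_of_nonneg_left ?_ (abs_nonneg _)
        rw [abs_of_nonneg (by positivity)]
        exact_mod_cast Nat.lt_succ_iff.1 (y j).2
      have h2 : ∑ j, |B i j| ≤ (M : ℤ) := by
        have : ∑ j, (B i j).natAbs ≤ M :=
          (Finset.single_le_sum (f := fun i => ∑ j, (B i j).natAbs)
            (fun _ _ => Nat.zero_le _) (Finset.mem_univ i)).trans (Nat.le_add_left _ _)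
        calc ∑ j, |B i j| = ((∑ j, (B i j).natAbs : ℕ) : ℤ) := by push_cast; rfl
          _ ≤ M := by exact_mod_cast this
      have h3 : (M : ℤ) * s ≤ t := by exact_mod_cast Nat.mul_div_le t M
      rw [← Finset.sum_mul] at h1
      exact h1.trans ((mul_le_mul_of_nonneg_right h2 (by positivity)).trans h3)
    · intro k
      exact (Finset.sum_nonneg (f := fun i => (Pi.single (f i) ((y i : ℕ) : ℤ) : Fin n → ℤ))
        fun i _ => Pi.single_nonneg.2 (by positivity)) k
    · rw [Matrix.mulVec_sum]
      ext i
      simp [hφ, Matrix.mulVec, dotProduct, hB]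
  have hcard : (s + 1) ^ m ≤ {b | b ∈ box m t ∧ (feasible A b).Nonempty}.ncard := by
    have h := Set.ncard_le_ncard hsub ((finite_box m t).subset fun b hb => hb.1)
    rwa [Set.ncard_range_of_injective hφ_inj, Nat.card_eq_fintype_card, Fintype.card_fun,
      Fintype.card_fin, Fintype.card_fin] at h
  have hMs : 2 * t + 1 ≤ 2 * M * (s + 1) := by
    have : t < M * (s + 1) := Nat.lt_mul_div_succ t (by omega)
    rw [mul_assoc]
    omega
  calc (2 * t + 1) ^ m ≤ (2 * M * (s + 1)) ^ m := Nat.pow_le_pow_left hMs m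
    _ = (2 * M) ^ m * (s + 1) ^ m := mul_pow _ _ _
    _ ≤ _ := Nat.mul_le_mul_left _ hcard

theorem exists_sigma_eq_and_le_iff {m n : ℕ} (A : Matrix (Fin m) (Fin n) ℤ) (b : Fin m → ℤ)
    (k : ℕ) : (∃ s : ℕ, sigma A b = (s : ℕ∞) ∧ (s : ℤ) ≤ k) ↔ sigma A b ≤ (k : ℕ∞) := by
  constructor
  · rintro ⟨s, hs, hsk⟩
    rw [hs]; exact_mod_cast hsk
  · intro h
    obtain ⟨s, hs⟩ := ENat.ne_top_iff_exists.1 (ne_top_of_le_ne_top (ENat.natCast_ne_top k) h)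
    rw [← hs] at h
    exact ⟨s, hs.symm, by exact_mod_cast h⟩

theorem feasible_nonempty_of_sigma_eq {m n : ℕ} {A : Matrix (Fin m) (Fin n) ℤ} {b : Fin m → ℤ}
    {s : ℕ} (h : sigma A b = (s : ℕ∞)) : (feasible A b).Nonempty := by
  by_contra hcon
  rw [Set.not_nonempty_iff_eq_empty] at hcon
  simp [sigma, hcon] at h

theorem mem_asySet_of_negligible {m n : ℕ} (A : Matrix (Fin m) (Fin n) ℤ) (f : Fin m → Fin n)
    (hdet : (A.submatrix id f).det ≠ 0) (k : ℕ)
    (h : Negligible {b | (feasible A b).Nonempty ∧ ¬ sigma A b ≤ (k : ℕ∞)}) :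
    (k : ℤ) ∈ asySet A := by
  obtain ⟨K, hK⟩ := h
  obtain ⟨K', hK'⟩ := exists_le_ncard_feasible A f hdet
  have hbound (t : ℕ) : 1 - (K * K' : ℝ) * (1 / ((2 * t + 1 : ℕ) : ℝ)) ≤ ratio A k t ∧
      ratio A k t ≤ 1 := by
    set F : Set (Fin m → ℤ) := {b | b ∈ box m t ∧ (feasible A b).Nonempty} with hF
    set G : Set (Fin m → ℤ) :=
      {b | b ∈ box m t ∧ ∃ s : ℕ, sigma A b = (s : ℕ∞) ∧ (s : ℤ) ≤ (k : ℤ)} with hG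
    set X := {b | (feasible A b).Nonempty ∧ ¬ sigma A b ≤ (k : ℕ∞)} ∩ box m t with hX
    have hFfin : F.Finite := (finite_box m t).subset fun b hb => hb.1
    have hGF : G ⊆ F := fun b ⟨hb, s, hs, _⟩ => ⟨hb, feasible_nonempty_of_sigma_eq hs⟩
    have hFX : F ⊆ G ∪ X := by
      rintro b ⟨hb, hbf⟩
      by_cases hσ : sigma A b ≤ (k : ℕ∞)
      · exact Or.inl ⟨hb, (exists_sigma_eq_and_le_iff A b k).2 hσ⟩
      · exact Or.inr ⟨⟨hbf, hσ⟩, hb⟩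
    have h1 : G.ncard ≤ F.ncard := Set.ncard_le_ncard hGF hFfin
    have h2 : F.ncard ≤ G.ncard + X.ncard :=
      (Set.ncard_le_ncard hFX ((hFfin.subset hGF).union
        ((finite_box m t).subset Set.inter_subset_right))).trans (Set.ncard_union_le _ _)
    have h3 : X.ncard * (2 * t + 1) ≤ K * K' * F.ncard :=
      (hK t).trans (by rw [mul_assoc]; exact Nat.mul_le_mul_left _ (hK' t))
    have hFpos : 0 < F.ncard := by
      refine Nat.pos_of_ne_zero fun h0 => ?_
      have := hK' t
      rw [← hF, h0, mul_zero] at this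
      exact absurd (Nat.le_zero.1 this) (by positivity)
    have hFpos' : (0 : ℝ) < F.ncard := by exact_mod_cast hFpos
    have ht : (0 : ℝ) < ((2 * t + 1 : ℕ) : ℝ) := by positivity
    have h2' : (F.ncard : ℝ) ≤ G.ncard + X.ncard := by exact_mod_cast h2
    have h3' : (X.ncard : ℝ) * ((2 * t + 1 : ℕ) : ℝ) ≤ K * K' * F.ncard := by exact_mod_cast h3
    change _ ≤ (G.ncard : ℝ) / F.ncard ∧ (G.ncard : ℝ) / F.ncard ≤ 1
    refine ⟨?_, (div_le_one hFpos').2 (by exact_mod_cast h1)⟩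
    rw [le_div_iff₀ hFpos', sub_mul, one_mul, sub_le_iff_le_add]
    have h4 : (X.ncard : ℝ) ≤ K * K' * (1 / ((2 * t + 1 : ℕ) : ℝ)) * F.ncard := by
      rw [mul_one_div, div_mul_eq_mul_div, le_div_iff₀ ht]
      exact h3'
    linarith
  have hlim : Tendsto (fun t : ℕ => 1 - (K * K' : ℝ) * (1 / ((2 * t + 1 : ℕ) : ℝ))) atTop
      (𝓝 1) := by
    have h1 : Tendsto (fun t : ℕ => (1 / ((2 * t + 1 : ℕ) : ℝ))) atTop (𝓝 0) := by
      have : Tendsto (fun t : ℕ => 2 * t + 1) atTop atTop :=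
        tendsto_atTop_mono (fun t => by dsimp only [id]; omega) tendsto_id
      exact tendsto_one_div_atTop_nhds_zero_nat.comp this
    simpa using (h1.const_mul (K * K' : ℝ)).const_sub 1
  exact tendsto_of_tendsto_of_tendsto_of_le_of_le hlim tendsto_const_nhds
    (fun t => (hbound t).1) (fun t => (hbound t).2)

theorem nonneg_of_mem_asySet {m n : ℕ} {A : Matrix (Fin m) (Fin n) ℤ} {k : ℤ}
    (hk : k ∈ asySet A) : 0 ≤ k := by
  by_contra hneg
  have h0 : ratio A k = fun _ => 0 := by
    funext t
    have : {b | b ∈ box m t ∧ ∃ s : ℕ, sigma A b = (s : ℕ∞) ∧ (s : ℤ) ≤ k} = ∅ := by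
      refine Set.eq_empty_of_forall_notMem ?_
      rintro b ⟨-, s, -, hs⟩
      omega
    simp [ratio, this]
  have hk' : Tendsto (ratio A k) atTop (𝓝 1) := hk
  rw [h0] at hk'
  exact zero_ne_one (tendsto_nhds_unique tendsto_const_nhds hk')

/-! ### Simplicial cones spanned by bases among the columns -/

/-- **Carathéodory's theorem for cones**: a nonnegative combination of finitely many vectors is a
nonnegative combination of linearly independent ones among them. -/
theorem exists_linearIndepOn_nonneg_combination {ι V : Type*} [AddCommGroup V] [Module ℝ V]
    (w : ι → V) (s : Finset ι) (c : ι → ℝ) (hc : ∀ i ∈ s, 0 ≤ c i) :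
    ∃ t ⊆ s, LinearIndepOn ℝ w (t : Set ι) ∧ ∃ d : ι → ℝ, (∀ i ∈ t, 0 ≤ d i) ∧
      ∑ i ∈ t, d i • w i = ∑ i ∈ s, c i • w i := by
  classical
  induction s using Finset.strongInduction generalizing c with
  | H s ih =>
  by_cases hs : LinearIndepOn ℝ w (s : Set ι)
  · exact ⟨s, subset_rfl, hs, c, hc, rfl⟩
  obtain ⟨g, hg, hpos⟩ : ∃ g : ι → ℝ, ∑ i ∈ s, g i • w i = 0 ∧ ∃ i ∈ s, 0 < g i := by
    rw [linearIndepOn_finset_iff] at hs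
    push Not at hs
    obtain ⟨g, hg, i, hi, hgi⟩ := hs
    rcases hgi.lt_or_gt with hlt | hgt
    · exact ⟨-g, by simp [hg], i, hi, by simpa using hlt⟩
    · exact ⟨g, hg, i, hi, hgt⟩
  -- the largest multiple of the relation `g` that keeps all coefficients nonnegative
  obtain ⟨i₀, hi₀, hmin⟩ := (s.filter fun i => 0 < g i).exists_min_image (fun i => c i / g i)
    (by obtain ⟨i, hi, hgi⟩ := hpos; exact ⟨i, Finset.mem_filter.2 ⟨hi, hgi⟩⟩)
  obtain ⟨hi₀s, hgi₀⟩ := Finset.mem_filter.1 hi₀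
  set r := c i₀ / g i₀ with hr
  have hr0 : 0 ≤ r := div_nonneg (hc _ hi₀s) hgi₀.le
  have hnonneg : ∀ i ∈ s, 0 ≤ c i - r * g i := by
    intro i hi
    rcases lt_or_ge 0 (g i) with hgi | hgi
    · have := hmin i (Finset.mem_filter.2 ⟨hi, hgi⟩)
      rw [le_div_iff₀ hgi] at this
      linarith
    · nlinarith [hc i hi, mul_nonneg hr0 (neg_nonneg.2 hgi)]
  have hzero : c i₀ - r * g i₀ = 0 := by rw [hr, div_mul_cancel₀ _ hgi₀.ne', sub_self]
  obtain ⟨t, hts, ht, d, hd, hsum⟩ := ih (s.erase i₀) (Finset.erase_ssubset hi₀s)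
    (fun i => c i - r * g i) fun i hi => hnonneg i (Finset.mem_of_mem_erase hi)
  refine ⟨t, hts.trans (Finset.erase_subset _ _), ht, d, hd, hsum.trans ?_⟩
  rw [Finset.sum_erase _ (by simp [hzero])]
  simp only [sub_smul, Finset.sum_sub_distrib, mul_smul, ← Finset.smul_sum, hg, smul_zero, sub_zero]

/-- A cone spanned by finitely many integer vectors that span the space is the union of the
simplicial cones spanned by its bases. -/
theorem exists_basis_of_mem_cone {m : ℕ} {ι : Type*} [Finite ι] (W : Matrix (Fin m) ι ℤ)
    (hspan : Submodule.span ℝ (Set.range fun j : ι => fun i : Fin m => (W i j : ℝ)) = ⊤)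
    {x : Fin m → ℝ} (hx : x ∈ cone W) :
    ∃ f : Fin m ↪ ι, (W.submatrix id f).det ≠ 0 ∧
      ∃ c : Fin m → ℝ, (∀ i, 0 ≤ c i) ∧
        x = ((W.submatrix id f).map (fun a : ℤ => (a : ℝ))) *ᵥ c := by
  classical
  have := Fintype.ofFinite ι
  set w : ι → Fin m → ℝ := fun j i => (W i j : ℝ) with hw
  obtain ⟨c, hc⟩ := (Submodule.mem_span_range_iff_exists_fun _).1 hx
  obtain ⟨t, -, ht, d, hd, hsum⟩ := exists_linearIndepOn_nonneg_combination w Finset.univ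
    (fun j => (c j : ℝ)) fun j _ => (c j).2
  have hsum' : ∑ j ∈ t, d j • w j = x := hsum.trans hc
  obtain ⟨b, -, htb, hb, hli⟩ := exists_linearIndepOn_extension ht (Set.subset_univ _)
  have htop : ⊤ ≤ Submodule.span ℝ (Set.range fun j : b => w j) := by
    rw [← hspan, Submodule.span_le, ← Set.image_univ, ← Set.image_eq_range]
    exact hb
  let bas := Module.Basis.mk hli htop
  have hcard : Fintype.card b = m := by
    rw [← Module.finrank_eq_card_basis bas, Module.finrank_fin_fun]
  let e : Fin m ≃ b := (Fintype.equivFinOfCardEq hcard).symm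
  refine ⟨e.toEmbedding.trans (Function.Embedding.subtype _), ?_, ?_⟩
  · set f : Fin m ↪ ι := e.toEmbedding.trans (Function.Embedding.subtype _)
    have hli' : LinearIndependent ℝ ((W.submatrix id f).map (fun a : ℤ => (a : ℝ))).col :=
      hli.comp e e.injective
    have hu := (Matrix.isUnit_iff_isUnit_det _).1
      (Matrix.linearIndependent_cols_iff_isUnit.1 hli')
    intro h0
    have : ((W.submatrix id f).map (fun a : ℤ => (a : ℝ))).det = 0 := by
      have := (Int.castRingHom ℝ).map_det (W.submatrix id f)
      rw [h0, map_zero] at this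
      exact this.symm
    exact hu.ne_zero this
  · refine ⟨fun i => if (e i : ι) ∈ t then d (e i) else 0, fun i => ?_, ?_⟩
    · dsimp only
      split_ifs with h
      exacts [hd _ h, le_rfl]
    · have h1 : ∑ i : Fin m, (if (e i : ι) ∈ t then d (e i) else 0) • w (e i) =
          ∑ j ∈ t, d j • w j := by
        rw [e.sum_comp fun j : b => (if (j : ι) ∈ t then d j else 0) • w j]
        rw [← Finset.sum_subtype (Finset.univ.filter (· ∈ b)) (by simp)
          (fun j => (if j ∈ t then d j else 0) • w j)]
        simp only [ite_smul, zero_smul]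
        rw [← Finset.sum_filter]
        refine Finset.sum_congr ?_ fun _ _ => rfl
        ext j
        simpa using fun hj => htb hj
      rw [← hsum', ← h1]
      ext i
      simp only [Matrix.mulVec, dotProduct, Finset.sum_apply, Pi.smul_apply, smul_eq_mul]
      exact Finset.sum_congr rfl fun j _ => mul_comm _ _

theorem span_cols_eq_top {m n : ℕ} {A : Matrix (Fin m) (Fin n) ℤ}
    (hA : (A.map (fun a : ℤ => (a : ℝ))).rank = m) {S : Finset (Fin n)}
    (hS : cone A = cone (cols A S)) :
    Submodule.span ℝ (Set.range fun j : S => fun i : Fin m => (cols A S i j : ℝ)) = ⊤ := by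
  have htop : Submodule.span ℝ (Set.range fun j : Fin n => fun i : Fin m => (A i j : ℝ)) = ⊤ := by
    refine Submodule.eq_top_of_finrank_eq ?_
    rw [Module.finrank_fin_fun]
    exact (Matrix.rank_eq_finrank_span_cols _).symm.trans hA
  rw [eq_top_iff, ← htop, Submodule.span_le]
  rintro _ ⟨j, rfl⟩
  refine PointedCone.hull_le_span ℝ _ ?_
  change _ ∈ cone (cols A S)
  rw [← hS]
  exact PointedCone.subset_hull ⟨j, rfl⟩

theorem mem_cone_of_feasible {m n : ℕ} {A : Matrix (Fin m) (Fin n) ℤ} {b : Fin m → ℤ}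
    (hb : (feasible A b).Nonempty) : (fun i => (b i : ℝ)) ∈ cone A := by
  obtain ⟨x, hx, rfl⟩ := hb
  have : (fun i => ((A *ᵥ x) i : ℝ)) =
      ∑ j, (⟨(x j : ℝ), by exact_mod_cast hx j⟩ : {r : ℝ // 0 ≤ r}) •
        (fun i : Fin m => (A i j : ℝ)) := by
    ext i
    simp [Matrix.mulVec, dotProduct, mul_comm, Finset.sum_apply, Nonneg.mk_smul]
  rw [this]
  exact Submodule.sum_mem _ fun j _ => Submodule.smul_mem _ _
    (PointedCone.subset_hull ⟨j, rfl⟩)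

/-! ### The bound for almost all right-hand sides -/

/-- If each basis `f` of `W` can be completed by at most `k` columns of `A` to a generating set of
the lattice of all columns, then `σ(A, b) ≤ m + k` for almost all feasible `b`: the exceptional
`b` lie near the facets of the simplicial cones spanned by the bases. -/
theorem add_mem_asySet {m n : ℕ} {A : Matrix (Fin m) (Fin n) ℤ}
    (hA : (A.map (fun a : ℤ => (a : ℝ))).rank = m) {S : Finset (Fin n)}
    (hS : cone A = cone (cols A S)) (k : ℕ)
    (h : ∀ f : Fin m ↪ S, ((cols A S).submatrix id f).det ≠ 0 →
      ∃ T : Finset (Fin n), T.card ≤ k ∧ ∀ j, A.col j ∈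
        LinearMap.range ((cols A S).submatrix id f).mulVecLin ⊔ Submodule.span ℤ (A.col '' T)) :
    ((m + k : ℕ) : ℤ) ∈ asySet A := by
  have hspan := span_cols_eq_top hA hS
  have key : ∀ f : {f : Fin m ↪ S // ((cols A S).submatrix id f).det ≠ 0}, ∃ C : ℤ,
      ∀ b, (feasible A b).Nonempty →
      (∀ i, C ≤ ((cols A S).submatrix id f.1).det.sign *
        (((cols A S).submatrix id f.1).adjugate *ᵥ b) i) →
      sigma A b ≤ ((m + k : ℕ) : ℕ∞) := by
    rintro ⟨f, hf⟩
    obtain ⟨T, hTk, hT⟩ := h f hf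
    obtain ⟨C, hC⟩ := exists_sigma_le_of_deep A (fun i => (f i : Fin n)) hf T hT
    refine ⟨C, fun b hb hdeep => (hC b hb hdeep).trans ?_⟩
    exact_mod_cast Nat.add_le_add_left hTk m
  choose C hC using key
  obtain ⟨f₀, hf₀, -⟩ := exists_basis_of_mem_cone (cols A S) hspan (zero_mem (cone (cols A S)))
  refine mem_asySet_of_negligible A (fun i => (f₀ i : Fin n)) hf₀ _ ?_
  have hslab (f : {f : Fin m ↪ S // ((cols A S).submatrix id f).det ≠ 0}) (i : Fin m) :
      Negligible {b : Fin m → ℤ | |((cols A S).submatrix id f.1).adjugate i ⬝ᵥ b| ≤ C f} := by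
    refine negligible_slab (fun hrow => f.2 ?_) _
    have h1 : (((cols A S).submatrix id f.1).adjugate *
        ((cols A S).submatrix id f.1)) i i = 0 := by
      rw [Matrix.mul_apply, hrow]
      simp
    rw [Matrix.adjugate_mul] at h1
    simpa using h1
  refine (Negligible.iUnion fun f => Negligible.iUnion fun i => hslab f i).mono ?_
  rintro b ⟨hb, hσ⟩
  have hcone := mem_cone_of_feasible hb
  rw [hS] at hcone
  obtain ⟨f, hf, c, hc, hbc⟩ := exists_basis_of_mem_cone _ hspan hcone
  have hnot : ¬ ∀ i, C ⟨f, hf⟩ ≤ _ := fun hdeep => hσ (hC ⟨f, hf⟩ b hb hdeep)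
  push Not at hnot
  obtain ⟨i, hi⟩ := hnot
  refine Set.mem_iUnion.2 ⟨⟨f, hf⟩, Set.mem_iUnion.2 ⟨i, ?_⟩⟩
  dsimp only at hi
  set B := (cols A S).submatrix id f with hB
  have hcast : (((B.adjugate *ᵥ b) i : ℤ) : ℝ) = B.det * c i := by
    have h1 : ((B.adjugate.map (fun a : ℤ => (a : ℝ))) *ᵥ fun i => (b i : ℝ)) =
        (B.det : ℝ) • c := by
      have h2 : B.adjugate.map (fun a : ℤ => (a : ℝ)) * B.map (fun a : ℤ => (a : ℝ)) =
          (B.det : ℝ) • 1 := by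
        have := congrArg (Int.castRingHom ℝ).mapMatrix (Matrix.adjugate_mul B)
        rw [map_mul] at this
        refine this.trans ?_
        ext p q
        change (((B.det • (1 : Matrix (Fin m) (Fin m) ℤ)) p q : ℤ) : ℝ) = _
        by_cases hpq : p = q <;> simp [Matrix.smul_apply, hpq]
      rw [hbc, Matrix.mulVec_mulVec, h2, Matrix.smul_mulVec, Matrix.one_mulVec]
    have h3 := congrFun h1 i
    rw [Pi.smul_apply, smul_eq_mul] at h3
    rw [← h3]
    simp [Matrix.mulVec, dotProduct]
  -- in the simplicial cone the scaled coordinates are nonnegative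
  have hnn : 0 ≤ B.det.sign * (B.adjugate *ᵥ b) i := by
    have h1 : (0 : ℝ) ≤ ((B.det.sign * (B.adjugate *ᵥ b) i : ℤ) : ℝ) := by
      rw [Int.cast_mul, hcast, ← mul_assoc, ← Int.cast_mul, Int.sign_mul_self_eq_abs]
      exact mul_nonneg (by exact_mod_cast abs_nonneg _) (hc i)
    exact_mod_cast h1
  change |(B.adjugate *ᵥ b) i| ≤ _
  have habs : |(B.adjugate *ᵥ b) i| = B.det.sign * (B.adjugate *ᵥ b) i := by
    rw [← abs_of_nonneg hnn, abs_mul, Int.abs_sign_of_ne_zero hf, one_mul]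
  rw [habs]
  exact hi.le

/-! ### Extremal minors -/

theorem finite_Delta {m : ℕ} {ι : Type*} [Finite ι] (W : Matrix (Fin m) ι ℤ) :
    (Delta W).Finite := by
  refine (Set.finite_range fun f : Fin m ↪ ι => (W.submatrix id f).det.natAbs).subset ?_
  rintro _ ⟨f, -, rfl⟩
  exact ⟨f, rfl⟩

theorem Phi_eq_image_Delta {m : ℕ} {ι : Type*} (W : Matrix (Fin m) ι ℤ) :
    Phi W = ArithmeticFunction.cardFactors '' Delta W := by
  ext t
  constructor
  · rintro ⟨f, hf, α, hα, hprod⟩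
    refine ⟨_, ⟨f, hf, rfl⟩, ?_⟩
    have hne : (Finset.univ.val.map α).prod ≠ 0 :=
      Finset.prod_ne_zero_iff.2 fun i _ => (hα i).ne_zero
    rw [hprod]
    refine (ArithmeticFunction.cardFactors_multiset_prod hne).trans ?_
    have hone : ArithmeticFunction.cardFactors ∘ α = fun _ => 1 :=
      funext fun i => ArithmeticFunction.cardFactors_apply_prime (hα i)
    rw [Multiset.map_map, hone]
    simp
  · rintro ⟨_, ⟨f, hf, rfl⟩, rfl⟩
    rw [ArithmeticFunction.cardFactors_apply]
    refine ⟨f, hf, fun i => (W.submatrix id f).det.natAbs.primeFactorsList.get i,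
      fun i => Nat.prime_of_mem_primeFactorsList (List.get_mem _ _), ?_⟩
    rw [← List.prod_ofFn, List.ofFn_get, Nat.prod_primeFactorsList (Int.natAbs_ne_zero.2 hf)]

theorem two_pow_cardFactors_le {d : ℕ} (hd : d ≠ 0) : 2 ^ ArithmeticFunction.cardFactors d ≤ d := by
  rw [ArithmeticFunction.cardFactors_apply]
  conv_rhs => rw [← Nat.prod_primeFactorsList hd]
  exact List.pow_card_le_prod _ _ fun p hp => (Nat.prime_of_mem_primeFactorsList hp).two_le

theorem cardFactors_le_logb {d : ℕ} (hd : d ≠ 0) :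
    (ArithmeticFunction.cardFactors d : ℝ) ≤ Real.logb 2 d := by
  rw [Real.le_logb_iff_rpow_le (by norm_num) (by positivity), Real.rpow_natCast]
  exact_mod_cast two_pow_cardFactors_le hd

theorem isGreatest_sSup_of_finite {s : Set ℕ} (hs : s.Finite) (hne : s.Nonempty) :
    IsGreatest s (sSup s) :=
  ⟨Nat.sSup_mem hne hs.bddAbove, fun _ h => le_csSup hs.bddAbove h⟩

theorem isLeast_sInf_nat {s : Set ℕ} (hne : s.Nonempty) : IsLeast s (sInf s) :=
  ⟨Nat.sInf_mem hne, fun _ h => Nat.sInf_le h⟩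

end SparseIP

/-- `A` is an integer matrix of full row rank and `W = cols A S` is a set of its columns that
generates the same cone. The first five conjuncts say that the minima and maxima in the
definitions of `σ^asy`, `δ^max`, `δ^min`, `φ^max` and `φ^min` are attained. -/
theorem theorem1 (m n : ℕ) (A : Matrix (Fin m) (Fin n) ℤ)
    (hA : (A.map (fun a : ℤ => (a : ℝ))).rank = m)
    (S : Finset (Fin n)) (hS : SparseIP.cone A = SparseIP.cone (SparseIP.cols A S)) :
    IsLeast (SparseIP.asySet A) (SparseIP.sigmaAsy A) ∧
    IsGreatest (SparseIP.Delta (SparseIP.cols A S)) (SparseIP.deltaMax (SparseIP.cols A S)) ∧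
    IsLeast (SparseIP.Delta (SparseIP.cols A S)) (SparseIP.deltaMin (SparseIP.cols A S)) ∧
    IsGreatest (SparseIP.Phi (SparseIP.cols A S)) (SparseIP.phiMax (SparseIP.cols A S)) ∧
    IsLeast (SparseIP.Phi (SparseIP.cols A S)) (SparseIP.phiMin (SparseIP.cols A S)) ∧
    ((SparseIP.sigmaAsy A : ℝ) ≤ (m : ℝ) + (SparseIP.phiMax (SparseIP.cols A S) : ℝ) ∧
      (m : ℝ) + (SparseIP.phiMax (SparseIP.cols A S) : ℝ) ≤
        (m : ℝ) + Real.logb 2 (SparseIP.deltaMax (SparseIP.cols A S) : ℝ)) ∧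
    ((SparseIP.sigmaAsy A : ℝ) ≤ 2 * (m : ℝ) + (SparseIP.phiMin (SparseIP.cols A S) : ℝ) ∧
      2 * (m : ℝ) + (SparseIP.phiMin (SparseIP.cols A S) : ℝ) ≤
        2 * (m : ℝ) + Real.logb 2 (SparseIP.deltaMin (SparseIP.cols A S) : ℝ)) := by
  classical
  set W := SparseIP.cols A S with hW
  have hΔfin := SparseIP.finite_Delta W
  have hΔne : (SparseIP.Delta W).Nonempty := by
    obtain ⟨f, hf, -⟩ := SparseIP.exists_basis_of_mem_cone W (SparseIP.span_cols_eq_top hA hS)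
      (zero_mem (SparseIP.cone W))
    exact ⟨_, f, hf, rfl⟩
  have hΦ := SparseIP.Phi_eq_image_Delta W
  have hδmax : IsGreatest (SparseIP.Delta W) (SparseIP.deltaMax W) :=
    SparseIP.isGreatest_sSup_of_finite hΔfin hΔne
  have hδmin : IsLeast (SparseIP.Delta W) (SparseIP.deltaMin W) := SparseIP.isLeast_sInf_nat hΔne
  have hφmax : IsGreatest (SparseIP.Phi W) (SparseIP.phiMax W) :=
    SparseIP.isGreatest_sSup_of_finite (hΦ ▸ hΔfin.image _) (hΦ ▸ hΔne.image _)
  have hφmin : IsLeast (SparseIP.Phi W) (SparseIP.phiMin W) :=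
    SparseIP.isLeast_sInf_nat (hΦ ▸ hΔne.image _)
  have hΔ0 : ∀ d ∈ SparseIP.Delta W, d ≠ 0 := by
    rintro _ ⟨f, hf, rfl⟩
    exact Int.natAbs_ne_zero.2 hf
  have hmax : ((m + SparseIP.phiMax W : ℕ) : ℤ) ∈ SparseIP.asySet A := by
    refine SparseIP.add_mem_asySet hA hS _ fun f hf => ?_
    obtain ⟨Y, hY, hgen⟩ := SparseIP.exists_card_le_cardFactors_det hf A.col
    exact ⟨Y, hY.trans (hφmax.2 (hΦ ▸ ⟨_, ⟨f, hf, rfl⟩, rfl⟩)), hgen⟩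
  have hmin : ((m + (m + SparseIP.phiMin W) : ℕ) : ℤ) ∈ SparseIP.asySet A := by
    have hmem := hφmin.1
    rw [hΦ] at hmem
    obtain ⟨_, ⟨g, hg, rfl⟩, hφ⟩ := hmem
    obtain ⟨Y, hY, hgen⟩ := SparseIP.exists_card_le_cardFactors_det hg A.col
    -- the basis `g` and the columns in `Y` generate the lattice without the help of `f`
    refine SparseIP.add_mem_asySet hA hS _ fun f _ =>
      ⟨Finset.univ.image (fun i => (g i : Fin n)) ∪ Y, ?_, fun j => ?_⟩
    · refine (Finset.card_union_le _ _).trans (Nat.add_le_add ?_ (hY.trans hφ.le))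
      simpa using Finset.card_image_le (s := Finset.univ) (f := fun i => (g i : Fin n))
    · refine Submodule.mem_sup_right ?_
      refine (sup_le ?_ (Submodule.span_mono (Set.image_mono (by simp))) :
        LinearMap.range (W.submatrix id g).mulVecLin ⊔ Submodule.span ℤ (A.col '' Y) ≤ _) (hgen j)
      rw [Matrix.range_mulVecLin]
      refine Submodule.span_mono ?_
      rintro _ ⟨i, rfl⟩
      exact ⟨g i, by simp, rfl⟩
  have hbdd : BddBelow (SparseIP.asySet A) := ⟨0, fun _ hk => SparseIP.nonneg_of_mem_asySet hk⟩
  refine ⟨⟨Int.csInf_mem ⟨_, hmax⟩ hbdd, fun _ hk => csInf_le hbdd hk⟩, hδmax, hδmin, hφmax, hφmin,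
    ⟨?_, ?_⟩, ?_, ?_⟩
  · have h : SparseIP.sigmaAsy A ≤ ((m + SparseIP.phiMax W : ℕ) : ℤ) := csInf_le hbdd hmax
    exact_mod_cast h
  · have hmem := hφmax.1
    rw [hΦ] at hmem
    obtain ⟨d, hd, hdφ⟩ := hmem
    have hd0 : (0 : ℝ) < d := by exact_mod_cast Nat.pos_of_ne_zero (hΔ0 d hd)
    rw [← hdφ]
    refine add_le_add_right ((SparseIP.cardFactors_le_logb (hΔ0 d hd)).trans ?_) _
    exact Real.logb_le_logb_of_le (by norm_num) hd0 (by exact_mod_cast hδmax.2 hd)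
  · have h : SparseIP.sigmaAsy A ≤ ((m + (m + SparseIP.phiMin W) : ℕ) : ℤ) := csInf_le hbdd hmin
    have h' : (SparseIP.sigmaAsy A : ℝ) ≤ (m : ℝ) + (m + SparseIP.phiMin W) := by exact_mod_cast h
    linarith
  · refine add_le_add_right (le_trans ?_ (SparseIP.cardFactors_le_logb (hΔ0 _ hδmin.1))) _
    exact_mod_cast hφmin.2 (hΦ ▸ Set.mem_image_of_mem _ hδmin.1)
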